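/- For complex numbers $a,q$ with $|q|<1$ and an integer $m\ge 0$ let $(a;q)_m=\prod_{j=0}^{m-1}(1-aq^j)$, $(a;q)_\infty=\prod_{j=0}^{\infty}(1-aq^j)$ and $(a_1,a_2,a_3;q)_\infty=(a_1;q)_\infty(a_2;q)_\infty(a_3;q)_\infty$. Then for every complex $q$ with $|q|<1$ the following six identities hold (in the fourth one $q\neq 0$ is assumed), where all double sums over integers $n,r\ge 0$ converge absolutely: $$\sum_{n,r\ge 0}\frac{q^{n^2+2r^2+2nr+2n+3r}\,(q;q)_{n+r+1}}{(q;q)_{2n+2r+2}(q;q)_r(q;q)_n}=\frac{(q,q^{12},q^{13};q^{13})_\infty}{(q;q)_\infty},$$ $$\sum_{n,r\ge 0}\frac{q^{n^2+2r^2+2nr+2n+3r}\,(q;q)_{n+r+1}\,(1+q^{r+1}+q^{n+1}-q^{n+r+1})}{(q;q)_{2n+2r+2}(q;q)_r(q;q)_n}=\frac{(q^2,q^{11},q^{13};q^{13})_\infty}{(q;q)_\infty},$$ $$\sum_{n,r\ge 0}\frac{q^{n^2+2r^2+2nr+2n+3r}\,(q;q)_{n+r+1}}{(q;q)_{2n+2r+2}(q;q)_r(q;q)_n}\Big((1-q^{n+r+1})(q^r+q^n)(1+q)-q^{n+r}+q^{2r+2}+q^{2n+2}+q^{2n+2r+1}+q^{n+r+2}\Big)=\frac{(q^3,q^{10},q^{13};q^{13})_\infty}{(q;q)_\infty},$$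 $$\sum_{n,r\ge 0}\frac{q^{n^2+2r^2+2nr-1}\,(q;q)_{n+r}}{(q;q)_{2n+2r}(q;q)_r(q;q)_n}\Big(q^r-1+q^{2r+1}+q^{n+r+1}-q^{n+2r}+q^n+q^{2n+1}-q^{2n+r}-q^{n+2r+1}-q^{2n+r+1}+q^{2n+2r}\Big)=\frac{(q^4,q^9,q^{13};q^{13})_\infty}{(q;q)_\infty},$$ $$\sum_{n,r\ge 0}\frac{q^{n^2+2r^2+2nr}\,(q;q)_{n+r}\,(q^n+q^r-q^{n+r})}{(q;q)_{2n+2r}(q;q)_r(q;q)_n}=\frac{(q^5,q^8,q^{13};q^{13})_\infty}{(q;q)_\infty},$$ $$\sum_{n,r\ge 0}\frac{q^{n^2+2r^2+2nr}\,(q;q)_{n+r}}{(q;q)_{2n+2r}(q;q)_r(q;q)_n}=\frac{(q^6,q^7,q^{13};q^{13})_\infty}{(q;q)_\infty}.$$ -/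

import Mathlib

noncomputable section

namespace QSeries

/-- The finite `q`-shifted factorial `(a; q)_m = ∏_{j=0}^{m-1} (1 - a q^j)`. -/
def qPoch (a q : ℂ) (m : ℕ) : ℂ := ∏ j ∈ Finset.range m, (1 - a * q ^ j)

/-- The infinite `q`-shifted factorial `(a; q)_∞ = ∏_{j ≥ 0} (1 - a q^j)`, for `|q| < 1`. -/
def qPochInf (a q : ℂ) : ℂ := ∏' j : ℕ, (1 - a * q ^ j)

/-- The product `(a₁, a₂, a₃; q)_∞ = (a₁; q)_∞ (a₂; q)_∞ (a₃; q)_∞`. -/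
def qPochInf₃ (a₁ a₂ a₃ q : ℂ) : ℂ := qPochInf a₁ q * qPochInf a₂ q * qPochInf a₃ q

/-- The infinite product defining `(a; q)_∞` converges whenever `|q| < 1`. -/
theorem multipliable_qPochInf (a : ℂ) {q : ℂ} (hq : ‖q‖ < 1) :
    Multipliable fun j : ℕ => 1 - a * q ^ j := by
  have h : Summable fun j : ℕ => -(a * q ^ j) :=
    ((summable_geometric_of_norm_lt_one hq).mul_left a).neg
  simpa only [sub_eq_add_neg] using Complex.multipliable_one_add_of_summable h

end QSeries

end

/-!
Write `n + r = N` in the double series. The inner sums are then combinations of the Rogers sums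
`∑_r q^(r² + kr) [N; r]`, and a simultaneous induction through the two `q`-Pascal recurrences
evaluates the alternating sums `∑_j (-1)^j q^(5j(j-1)/2 + bj) [2N; N + c + 2j]` of Bressoud in
terms of the Rogers sums with `k = 0, 1`. The outer series thus become
`∑_N q^(N²) / (q; q)_{2N}` times a Bressoud sum. Summing over Durfee rectangles,
`∑_N q^(N²) / ((q; q)_{N-k} (q; q)_{N+k}) = q^(k²) / (q; q)_∞`, which for `k = c + 2j` raises the
quadratic exponent `5j²/2` to `13j²/2`; Jacobi's triple product sums the resulting theta series.
-/

namespace QSeries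

open Filter Topology Finset

/-! ### Gaussian binomial sums -/

theorem qPoch_succ (a q : ℂ) (m : ℕ) : qPoch a q (m + 1) = qPoch a q m * (1 - a * q ^ m) :=
  prod_range_succ _ m

theorem qPoch_self_succ (q : ℂ) (m : ℕ) :
    qPoch q q (m + 1) = qPoch q q m * (1 - q ^ (m + 1)) := by
  rw [qPoch_succ, ← pow_succ']

theorem qPoch_self_ne_zero {q : ℂ} (hq : ∀ m : ℕ, q ^ (m + 1) ≠ 1) (m : ℕ) : qPoch q q m ≠ 0 :=
  prod_ne_zero_iff.mpr fun j _ => by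
    rw [← pow_succ']
    exact sub_ne_zero.mpr (hq j).symm

/-- The reciprocal `1 / (q; q)_k`, extended by zero to negative integers `k`. -/
noncomputable def qPochInv (q : ℂ) (k : ℤ) : ℂ := if k < 0 then 0 else (qPoch q q k.toNat)⁻¹

theorem qPochInv_natCast (q : ℂ) (m : ℕ) : qPochInv q m = (qPoch q q m)⁻¹ := by
  simp [qPochInv]

theorem qPochInv_of_neg (q : ℂ) {k : ℤ} (hk : k < 0) : qPochInv q k = 0 := if_pos hk

theorem qPochInv_zero (q : ℂ) : qPochInv q 0 = 1 := by simp [qPochInv, qPoch]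

theorem qPochInv_sub_one {q : ℂ} (hq : ∀ m : ℕ, q ^ (m + 1) ≠ 1) (k : ℤ) :
    qPochInv q (k - 1) = (1 - q ^ k) * qPochInv q k := by
  rcases lt_trichotomy k 0 with hk | rfl | hk
  · rw [qPochInv_of_neg q hk, qPochInv_of_neg q (by omega), mul_zero]
  · rw [qPochInv_of_neg q (by norm_num), zpow_zero, sub_self, zero_mul]
  · obtain ⟨m, rfl⟩ : ∃ m : ℕ, k = (m + 1 : ℕ) := ⟨(k - 1).toNat, by omega⟩
    have hm : 1 - q ^ (m + 1) ≠ 0 := sub_ne_zero.mpr (hq m).symm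
    rw [show ((m + 1 : ℕ) : ℤ) - 1 = m by push_cast; ring, qPochInv_natCast, qPochInv_natCast,
      qPoch_self_succ, zpow_natCast, mul_inv, mul_comm, inv_mul_cancel_right₀ hm]

/-- The Gaussian binomial coefficient, which vanishes unless `0 ≤ k ≤ M`. -/
noncomputable def qBinom (q : ℂ) (M : ℕ) (k : ℤ) : ℂ :=
  qPoch q q M * qPochInv q k * qPochInv q (M - k)

theorem qBinom_of_neg (q : ℂ) (M : ℕ) {k : ℤ} (hk : k < 0) : qBinom q M k = 0 := by
  rw [qBinom, qPochInv_of_neg q hk, mul_zero, zero_mul]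

theorem qBinom_of_lt (q : ℂ) {M : ℕ} {k : ℤ} (hk : M < k) : qBinom q M k = 0 := by
  rw [qBinom, qPochInv_of_neg q (sub_neg.mpr hk), mul_zero]

theorem qBinom_zero (q : ℂ) (k : ℤ) : qBinom q 0 k = if k = 0 then 1 else 0 := by
  split_ifs with hk
  · simp [hk, qBinom, qPochInv_zero, qPoch]
  · rcases lt_or_gt_of_ne hk with h | h
    · exact qBinom_of_neg q 0 h
    · exact qBinom_of_lt q (by exact_mod_cast h)

theorem qBinom_symm (q : ℂ) (M : ℕ) (k : ℤ) : qBinom q M (M - k) = qBinom q M k := by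
  rw [qBinom, qBinom, sub_sub_cancel, mul_right_comm]

theorem qBinom_add (q : ℂ) (n r : ℕ) :
    qBinom q (n + r) r = qPoch q q (n + r) / (qPoch q q r * qPoch q q n) := by
  rw [qBinom, qPochInv_natCast, Nat.cast_add, add_sub_cancel_right, qPochInv_natCast,
    div_eq_mul_inv, mul_inv, mul_assoc]

theorem qBinom_succ {q : ℂ} (hq : ∀ m : ℕ, q ^ (m + 1) ≠ 1) (hq0 : q ≠ 0) (M : ℕ) (k : ℤ) :
    qBinom q (M + 1) k = qBinom q M (k - 1) + q ^ k * qBinom q M k := by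
  have hlow := qPochInv_sub_one hq k
  have hhigh := qPochInv_sub_one hq (M + 1 - k)
  have hpow : q ^ (M + 1) = q ^ k * q ^ ((M : ℤ) + 1 - k) := by
    rw [← zpow_add₀ hq0, add_sub_cancel, ← Nat.cast_add_one, zpow_natCast]
  simp only [qBinom]
  rw [Nat.cast_add_one, qPoch_self_succ, hlow, show (M : ℤ) - k = M + 1 - k - 1 by ring, hhigh,
    show (M : ℤ) - (k - 1) = M + 1 - k by ring, hpow]
  ring

theorem qBinom_succ' {q : ℂ} (hq : ∀ m : ℕ, q ^ (m + 1) ≠ 1) (hq0 : q ≠ 0) (M : ℕ) (k : ℤ) :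
    qBinom q (M + 1) k = qBinom q M k + q ^ (M + 1 - k) * qBinom q M (k - 1) := by
  rw [← qBinom_symm, qBinom_succ hq hq0, ← qBinom_symm q M k, ← qBinom_symm q M (k - 1)]
  push_cast
  rw [show (M : ℤ) + 1 - k - 1 = M - k by ring, show (M : ℤ) - (k - 1) = M + 1 - k by ring]

/-- The sum `∑_j α_j [M; c + d j]_q` over all integers `j`, where `[M; k]_q` is the Gaussian
binomial coefficient. For `d ≠ 0` it has finitely many nonzero terms. -/
noncomputable def qBinomSum (q : ℂ) (d : ℤ) (M : ℕ) (c : ℤ) (α : ℤ → ℂ) : ℂ :=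
  ∑' j : ℤ, α j * qBinom q M (c + d * j)

theorem summable_mul_qBinom (q : ℂ) {d : ℤ} (hd : d ≠ 0) (M : ℕ) (c : ℤ) (α : ℤ → ℂ) :
    Summable fun j : ℤ => α j * qBinom q M (c + d * j) := by
  have hinj : Function.Injective fun j : ℤ => c + d * j := fun i j h =>
    mul_left_cancel₀ hd (add_left_cancel h)
  refine summable_of_hasFiniteSupport
    (((Set.finite_Icc 0 (M : ℤ)).preimage hinj.injOn).subset fun j hj => ?_)
  by_contra hout
  rcases lt_or_ge (c + d * j) 0 with h | h
  · exact hj (by simp only [qBinom_of_neg q M h, mul_zero])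
  · exact hj (by simp only [qBinom_of_lt q (not_le.mp fun hle => hout ⟨h, hle⟩), mul_zero])

theorem qBinomSum_zero (q : ℂ) {d : ℤ} (hd : d ≠ 0) (α : ℤ → ℂ) : qBinomSum q d 0 0 α = α 0 := by
  simp [qBinomSum, qBinom_zero, hd]

theorem qBinomSum_zero_of_not_dvd (q : ℂ) {d c : ℤ} (hd : ¬ d ∣ c) (α : ℤ → ℂ) :
    qBinomSum q d 0 c α = 0 := by
  refine (tsum_congr fun j => ?_).trans tsum_zero
  rw [qBinom_zero, if_neg fun h => hd ⟨-j, by linarith⟩, mul_zero]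

theorem qBinomSum_const_mul (q : ℂ) (d : ℤ) (M : ℕ) (c : ℤ) (x : ℂ) (α : ℤ → ℂ) :
    qBinomSum q d M c (fun j => x * α j) = x * qBinomSum q d M c α := by
  simp only [qBinomSum, mul_assoc, tsum_mul_left]

theorem qBinomSum_succ {q : ℂ} (hq : ∀ m : ℕ, q ^ (m + 1) ≠ 1) (hq0 : q ≠ 0) {d : ℤ} (hd : d ≠ 0)
    (M : ℕ) (c : ℤ) (α : ℤ → ℂ) :
    qBinomSum q d (M + 1) c α =
      qBinomSum q d M (c - 1) α + q ^ c * qBinomSum q d M c (fun j => (q ^ d) ^ j * α j) := by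
  rw [← qBinomSum_const_mul]
  simp only [qBinomSum]
  rw [← (summable_mul_qBinom q hd M _ _).tsum_add (summable_mul_qBinom q hd M _ _)]
  refine tsum_congr fun j => ?_
  rw [qBinom_succ hq hq0, zpow_add₀ hq0, zpow_mul, add_sub_right_comm]
  ring

theorem qBinomSum_reflect (q : ℂ) (d : ℤ) (M : ℕ) (c : ℤ) (α : ℤ → ℂ) :
    qBinomSum q d M c α = qBinomSum q d M (M - c) (fun j => α (-j)) := by
  simp only [qBinomSum]
  rw [← (Equiv.neg ℤ).tsum_eq]
  refine tsum_congr fun j => ?_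
  rw [Equiv.neg_apply, ← qBinom_symm]
  congr 2
  ring

theorem qBinomSum_shift (q : ℂ) (d : ℤ) (M : ℕ) (c : ℤ) (α : ℤ → ℂ) :
    qBinomSum q d M c α = qBinomSum q d M (c + d) (fun j => α (j + 1)) := by
  simp only [qBinomSum]
  rw [← (Equiv.addRight (1 : ℤ)).tsum_eq]
  refine tsum_congr fun j => ?_
  rw [Equiv.coe_addRight, mul_add, mul_one, add_assoc, add_comm d]

theorem qBinomSum_succ' {q : ℂ} (hq : ∀ m : ℕ, q ^ (m + 1) ≠ 1) (hq0 : q ≠ 0) {d : ℤ} (hd : d ≠ 0)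
    (M : ℕ) (c : ℤ) (α : ℤ → ℂ) :
    qBinomSum q d (M + 1) c α = qBinomSum q d M c α +
      q ^ (M + 1 - c) * qBinomSum q d M (c - 1) (fun j => (q ^ (-d)) ^ j * α j) := by
  rw [← qBinomSum_const_mul]
  simp only [qBinomSum]
  rw [← (summable_mul_qBinom q hd M _ _).tsum_add (summable_mul_qBinom q hd M _ _)]
  refine tsum_congr fun j => ?_
  rw [qBinom_succ' hq hq0, ← zpow_mul, ← sub_sub, add_sub_right_comm c, sub_eq_add_neg _ (d * j),
    zpow_add₀ hq0, neg_mul]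
  ring

/-! ### Theta terms -/

theorem choose_add_one_two (j : ℤ) : Ring.choose (j + 1) 2 = Ring.choose j 2 + j := by
  simpa [add_comm] using Ring.choose_succ_succ j 1

theorem two_mul_choose_two (j : ℤ) : 2 * Ring.choose j 2 = j * (j - 1) := by
  simpa [descPochhammer_succ_right, Polynomial.smeval_mul, Polynomial.smeval_sub,
    Nat.factorial] using (Ring.descPochhammer_eq_factorial_smul_choose j 2).symm

theorem choose_neg_two (j : ℤ) : Ring.choose (-j) 2 = Ring.choose j 2 + j := by
  have h := two_mul_choose_two (-j)
  have h' := two_mul_choose_two j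
  linarith

/-- The general term `(-1)^j z^j q^(j(j-1)/2)` of Jacobi's theta series. -/
noncomputable def thetaTerm (q z : ℂ) (j : ℤ) : ℂ := (-1) ^ j * z ^ j * q ^ Ring.choose j 2

theorem thetaTerm_zero (q z : ℂ) : thetaTerm q z 0 = 1 := by
  simp [thetaTerm]

theorem thetaTerm_add_one {q z : ℂ} (hq0 : q ≠ 0) (hz : z ≠ 0) (j : ℤ) :
    thetaTerm q z (j + 1) = -(z * q ^ j) * thetaTerm q z j := by
  rw [thetaTerm, thetaTerm, choose_add_one_two, zpow_add₀ hq0, zpow_add_one₀ hz,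
    zpow_add_one₀ (neg_ne_zero.mpr one_ne_zero)]
  ring

theorem thetaTerm_neg {q : ℂ} (hq0 : q ≠ 0) (z : ℂ) (j : ℤ) :
    thetaTerm q z (-j) = thetaTerm q (q / z) j := by
  rw [thetaTerm, thetaTerm, choose_neg_two, zpow_add₀ hq0, div_zpow, zpow_neg, zpow_neg,
    ← inv_zpow, inv_neg_one]
  ring

theorem zpow_mul_thetaTerm (q z w : ℂ) (j : ℤ) :
    w ^ j * thetaTerm q z j = thetaTerm q (z * w) j := by
  rw [thetaTerm, thetaTerm, mul_zpow]
  ring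

/-! ### Bressoud sums and Rogers sums -/

/-- The alternating sum `∑_j (-1)^j q^(5j(j-1)/2 + bj) [M; c + 2j]_q` of Bressoud's
polynomial Rogers–Ramanujan identities. In lemma names, `even`, `half` and `odd` stand for the
offsets `c - M/2 = 0, 1/2, 1`. -/
noncomputable def bressoudSum (q : ℂ) (M : ℕ) (c b : ℤ) : ℂ :=
  qBinomSum q 2 M c (thetaTerm (q ^ 5) (q ^ b))

/-- The polynomial `∑_r q^(r² + kr) [N; r]_q`, which tends to the Rogers–Ramanujan series
`∑_r q^(r² + kr) / (q; q)_r`. -/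
noncomputable def rogersSum (q : ℂ) (k : ℤ) (N : ℕ) : ℂ :=
  qBinomSum q 1 N 0 fun r => q ^ (r ^ 2 + k * r)

theorem bressoudSum_zero_zero (q : ℂ) (b : ℤ) : bressoudSum q 0 0 b = 1 := by
  rw [bressoudSum, qBinomSum_zero q two_ne_zero, thetaTerm_zero]

theorem bressoudSum_zero_one (q : ℂ) (b : ℤ) : bressoudSum q 0 1 b = 0 :=
  qBinomSum_zero_of_not_dvd q (by norm_num) _

theorem rogersSum_zero (q : ℂ) (k : ℤ) : rogersSum q k 0 = 1 := by
  rw [rogersSum, qBinomSum_zero q one_ne_zero]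
  simp

section Recurrences

variable {q : ℂ} (hq : ∀ m : ℕ, q ^ (m + 1) ≠ 1) (hq0 : q ≠ 0)
include hq hq0

theorem rogersSum_succ (k : ℤ) (N : ℕ) :
    rogersSum q k (N + 1) = rogersSum q (k + 1) N + q ^ (k + 1) * rogersSum q (k + 2) N := by
  rw [rogersSum, qBinomSum_succ hq hq0 one_ne_zero, qBinomSum_shift, sub_add_cancel, zpow_zero,
    one_mul, add_comm, rogersSum, rogersSum, ← qBinomSum_const_mul]
  congr 2 <;> ext r
  · rw [zpow_one, ← zpow_add₀ hq0]
    ring_nf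
  · rw [← zpow_add₀ hq0]
    ring_nf

theorem rogersSum_succ' (k : ℤ) (N : ℕ) :
    rogersSum q k (N + 1) = rogersSum q k N + q ^ N * q ^ (k + 1) * rogersSum q (k + 1) N := by
  rw [rogersSum, qBinomSum_succ' hq hq0 one_ne_zero, qBinomSum_shift q 1 N (0 - 1), sub_add_cancel,
    rogersSum, rogersSum, ← qBinomSum_const_mul, ← qBinomSum_const_mul]
  congr 2
  ext r
  rw [← zpow_natCast, ← zpow_mul, ← zpow_add₀ hq0, ← zpow_add₀ hq0, ← zpow_add₀ hq0,
    ← zpow_add₀ hq0]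
  ring_nf

theorem rogersSum_contiguous (k : ℤ) (N : ℕ) :
    rogersSum q k N = (1 - q ^ N * q ^ (k + 1)) * rogersSum q (k + 1) N +
      q ^ (k + 1) * rogersSum q (k + 2) N := by
  linear_combination rogersSum_succ hq hq0 k N - rogersSum_succ' hq hq0 k N

theorem rogersSum_neg_one (N : ℕ) :
    rogersSum q (-1) N = (1 - q ^ N) * rogersSum q 0 N + rogersSum q 1 N := by
  simpa using rogersSum_contiguous hq hq0 (-1) N

theorem mul_rogersSum_neg_two (N : ℕ) : q * rogersSum q (-2) N =
    (q - q ^ N) * rogersSum q (-1) N + rogersSum q 0 N := by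
  have h := rogersSum_contiguous hq hq0 (-2) N
  norm_num at h
  field_simp at h
  linear_combination h

theorem mul_rogersSum_two (N : ℕ) : q * rogersSum q 2 N =
    rogersSum q 0 N - (1 - q ^ (N + 1)) * rogersSum q 1 N := by
  have h := rogersSum_contiguous hq hq0 0 N
  norm_num at h
  linear_combination -h

theorem sq_mul_rogersSum_three (N : ℕ) : q ^ 2 * rogersSum q 3 N =
    rogersSum q 1 N - (1 - q ^ (N + 2)) * rogersSum q 2 N := by
  have h := rogersSum_contiguous hq hq0 1 N
  norm_num at h
  linear_combination -h

theorem bressoudSum_succ (M : ℕ) (c b : ℤ) :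
    bressoudSum q (M + 1) c b = bressoudSum q M (c - 1) b + q ^ c * bressoudSum q M c (b + 2) := by
  simp only [bressoudSum, qBinomSum_succ hq hq0 two_ne_zero, zpow_mul_thetaTerm,
    ← zpow_add₀ hq0]

theorem bressoudSum_succ' (M : ℕ) (c b : ℤ) :
    bressoudSum q (M + 1) c b =
      bressoudSum q M c b + q ^ (M + 1 - c) * bressoudSum q M (c - 1) (b - 2) := by
  simp only [bressoudSum, qBinomSum_succ' hq hq0 two_ne_zero, zpow_mul_thetaTerm,
    ← zpow_add₀ hq0, ← sub_eq_add_neg]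

omit hq in
theorem bressoudSum_reflect (M : ℕ) (c b : ℤ) :
    bressoudSum q M c b = bressoudSum q M (M - c) (5 - b) := by
  rw [bressoudSum, qBinomSum_reflect]
  simp only [bressoudSum, thetaTerm_neg (pow_ne_zero 5 hq0), zpow_sub₀ hq0, zpow_ofNat]

omit hq in
theorem bressoudSum_shift (M : ℕ) (c b : ℤ) :
    bressoudSum q M c b = -q ^ b * bressoudSum q M (c + 2) (b + 5) := by
  rw [bressoudSum, qBinomSum_shift, bressoudSum, ← qBinomSum_const_mul]
  simp only [thetaTerm_add_one (pow_ne_zero 5 hq0) (zpow_ne_zero b hq0), zpow_add₀ hq0, zpow_ofNat,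
    ← zpow_mul_thetaTerm, neg_mul, mul_assoc]

end Recurrences

section Evaluations

variable {q : ℂ} (hq : ∀ m : ℕ, q ^ (m + 1) ≠ 1) (hq0 : q ≠ 0)
include hq hq0

omit hq in
theorem bressoudSum_even_reflect (m : ℕ) (b : ℤ) :
    bressoudSum q (2 * m) m b = bressoudSum q (2 * m) m (5 - b) := by
  rw [bressoudSum_reflect hq0]
  congr 1
  push_cast
  ring

omit hq in
theorem bressoudSum_odd_reflect (m : ℕ) (b : ℤ) :
    bressoudSum q (2 * m) (m + 1) b =
      -q ^ (5 - b) * bressoudSum q (2 * m) (m + 1) (10 - b) := by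
  rw [bressoudSum_reflect hq0, bressoudSum_shift hq0]
  congr 2
  · push_cast
    ring
  · ring

omit hq in
theorem bressoudSum_odd_five (m : ℕ) : bressoudSum q (2 * m) (m + 1) 5 = 0 := by
  have h := bressoudSum_odd_reflect hq0 m 5
  norm_num at h
  linear_combination (1 / 2 : ℂ) * h

theorem bressoudSum_half (m : ℕ) (b : ℤ) :
    bressoudSum q (2 * m + 1) (m + 1) b =
      bressoudSum q (2 * m) m b + q ^ (m + 1) * bressoudSum q (2 * m) (m + 1) (b + 2) := by
  rw [bressoudSum_succ hq hq0, add_sub_cancel_right]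
  norm_cast

theorem bressoudSum_half' (m : ℕ) (b : ℤ) :
    bressoudSum q (2 * m + 1) (m + 1) b =
      bressoudSum q (2 * m) (m + 1) b + q ^ m * bressoudSum q (2 * m) m (b - 2) := by
  rw [bressoudSum_succ' hq hq0, add_sub_cancel_right, ← zpow_natCast q m]
  congr 3
  push_cast
  ring

theorem bressoudSum_even_succ (m : ℕ) (b : ℤ) :
    bressoudSum q (2 * (m + 1)) (m + 1 : ℕ) b = bressoudSum q (2 * m + 1) (m + 1) b +
      q ^ (m + 1) * bressoudSum q (2 * m + 1) (m + 1) (7 - b) := by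
  rw [mul_add_one, bressoudSum_succ' hq hq0, bressoudSum_reflect hq0 _ _ (b - 2),
    ← zpow_natCast q (m + 1)]
  push_cast
  ring_nf

theorem bressoudSum_odd_succ (m : ℕ) (b : ℤ) :
    bressoudSum q (2 * (m + 1)) ((m + 1 : ℕ) + 1) b = bressoudSum q (2 * m + 1) (m + 1) b -
      q ^ m * q ^ (5 - b) * bressoudSum q (2 * m + 1) (m + 1) (8 - b) := by
  rw [mul_add_one, bressoudSum_succ hq hq0, bressoudSum_reflect hq0 _ _ (b + 2),
    bressoudSum_shift hq0 _ _ (5 - (b + 2)), ← zpow_natCast q m, ← zpow_add₀ hq0, neg_mul,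
    mul_neg, ← mul_assoc, ← zpow_add₀ hq0]
  push_cast
  ring_nf

theorem bressoudSum_eq_rogersSum (m : ℕ) :
    bressoudSum q (2 * m) m 3 = rogersSum q 0 m ∧
      bressoudSum q (2 * m + 1) (m + 1) 4 = rogersSum q 1 m := by
  induction m with
  | zero =>
    have hhalf := bressoudSum_half' hq hq0 0 4
    simp only [mul_zero, Nat.cast_zero, zero_add, pow_zero, one_mul] at hhalf ⊢
    simp only [hhalf, bressoudSum_zero_zero, bressoudSum_zero_one, rogersSum_zero, zero_add,
      and_self]
  | succ m ih =>
    obtain ⟨heven, hodd⟩ := ih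
    have half3 : bressoudSum q (2 * m + 1) (m + 1) 3 = rogersSum q 0 m := by
      simpa [bressoudSum_odd_five hq0, heven] using bressoudSum_half hq hq0 m 3
    have odd4 : bressoudSum q (2 * (m + 1)) ((m + 1 : ℕ) + 1) 4 =
        rogersSum q 1 m - q ^ m * q * rogersSum q 1 m := by
      simpa [hodd] using bressoudSum_odd_succ hq hq0 m 4
    have rogers0 : rogersSum q 0 (m + 1) = rogersSum q 1 m + q * rogersSum q 2 m := by
      simpa using rogersSum_succ hq hq0 0 m
    have rogers0' : rogersSum q 0 (m + 1) = rogersSum q 0 m + q ^ m * q * rogersSum q 1 m := by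
      simpa using rogersSum_succ' hq hq0 0 m
    have rogers1' : rogersSum q 1 (m + 1) = rogersSum q 1 m + q ^ m * q ^ 2 * rogersSum q 2 m := by
      simpa [one_add_one_eq_two] using rogersSum_succ' hq hq0 1 m
    have even3 : bressoudSum q (2 * (m + 1)) (m + 1 : ℕ) 3 = rogersSum q 0 (m + 1) := by
      rw [bressoudSum_even_succ hq hq0, half3, rogers0']
      norm_num [hodd, pow_succ]
    refine ⟨even3, ?_⟩
    rw [bressoudSum_half' hq hq0, odd4, bressoudSum_even_reflect hq0]
    norm_num only
    rw [even3]
    linear_combination q ^ (m + 1) * rogers0 - rogers1'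

theorem bressoudSum_even_three (m : ℕ) : bressoudSum q (2 * m) m 3 = rogersSum q 0 m :=
  (bressoudSum_eq_rogersSum hq hq0 m).1

theorem bressoudSum_half_four (m : ℕ) :
    bressoudSum q (2 * m + 1) (m + 1) 4 = rogersSum q 1 m :=
  (bressoudSum_eq_rogersSum hq hq0 m).2

theorem bressoudSum_half_three (m : ℕ) :
    bressoudSum q (2 * m + 1) (m + 1) 3 = rogersSum q 0 m := by
  simpa [bressoudSum_odd_five hq0, bressoudSum_even_three hq hq0] using
    bressoudSum_half hq hq0 m 3

theorem bressoudSum_half_five (m : ℕ) :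
    bressoudSum q (2 * m + 1) (m + 1) 5 = q ^ m * rogersSum q 0 m := by
  simpa [bressoudSum_odd_five hq0, bressoudSum_even_three hq hq0] using
    bressoudSum_half' hq hq0 m 5

theorem bressoudSum_odd_four (m : ℕ) :
    bressoudSum q (2 * m) (m + 1) 4 = rogersSum q 1 m - q ^ m * rogersSum q 0 m := by
  have hhalf := bressoudSum_half' hq hq0 m 4
  have heven : bressoudSum q (2 * m) m 2 = rogersSum q 0 m := by
    simpa [bressoudSum_even_three hq hq0] using bressoudSum_even_reflect hq0 m 2
  norm_num [bressoudSum_half_four hq hq0, heven] at hhalf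
  linear_combination -hhalf

theorem bressoudSum_even_four (m : ℕ) : bressoudSum q (2 * m) m 4 =
    (1 + q ^ m) * rogersSum q 1 m - q ^ (2 * m) * rogersSum q 0 m := by
  have hhalf := bressoudSum_half hq hq0 m 4
  have hodd := bressoudSum_odd_reflect hq0 m 4
  norm_num [bressoudSum_half_four hq hq0, bressoudSum_odd_four hq hq0] at hhalf hodd
  linear_combination -hhalf - q ^ m * hodd

theorem bressoudSum_odd_three (m : ℕ) : bressoudSum q (2 * m) (m + 1) 3 =
    (1 + q ^ (3 * m)) * rogersSum q 0 m - q ^ m * (1 + q ^ m) * rogersSum q 1 m := by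
  have hhalf := bressoudSum_half' hq hq0 m 3
  have heven := bressoudSum_even_reflect hq0 m 1
  norm_num [bressoudSum_half_three hq hq0, bressoudSum_even_four hq hq0] at hhalf heven
  linear_combination -hhalf - q ^ m * heven

theorem mul_bressoudSum_even_five (m : ℕ) : q * bressoudSum q (2 * m) m 5 =
    q ^ m * (1 + q + q ^ (3 * m)) * rogersSum q 0 m
      - q ^ (2 * m) * (1 + q ^ m) * rogersSum q 1 m := by
  have hhalf := bressoudSum_half hq hq0 m 5
  have hodd := bressoudSum_odd_reflect hq0 m 3
  norm_num [bressoudSum_half_five hq hq0, bressoudSum_odd_three hq hq0] at hhalf hodd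
  linear_combination -q * hhalf - q ^ m * hodd

theorem bressoudSum_odd_succ_four (m : ℕ) :
    bressoudSum q (2 * (m + 1)) ((m + 1 : ℕ) + 1) 4 =
      (1 - q ^ (m + 1)) * rogersSum q 1 m := by
  have hodd := bressoudSum_odd_succ hq hq0 m 4
  norm_num [bressoudSum_half_four hq hq0] at hodd ⊢
  linear_combination hodd

theorem bressoudSum_odd_succ_three (m : ℕ) :
    bressoudSum q (2 * (m + 1)) ((m + 1 : ℕ) + 1) 3 =
      (1 - q ^ (2 * m + 2)) * rogersSum q 0 m := by
  have hodd := bressoudSum_odd_succ hq hq0 m 3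
  norm_num [bressoudSum_half_three hq hq0, bressoudSum_half_five hq hq0] at hodd ⊢
  linear_combination hodd

theorem bressoudSum_odd_succ_two (m : ℕ) :
    bressoudSum q (2 * (m + 1)) ((m + 1 : ℕ) + 1) 2 = (1 - q ^ (m + 1)) *
      ((1 + q ^ (m + 1)) * (1 - q ^ (2 * m + 1)) * rogersSum q 0 m +
        q ^ (m + 1) * (1 + q + q ^ (m + 1)) * rogersSum q 1 m) := by
  have hodd := bressoudSum_odd_succ hq hq0 m 2
  have half2 := bressoudSum_half hq hq0 m 2
  have half6 := bressoudSum_half' hq hq0 m 6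
  have hrefl := bressoudSum_even_reflect hq0 m 2
  have hrefl' := bressoudSum_odd_reflect hq0 m 4
  norm_num [bressoudSum_even_three hq hq0, bressoudSum_even_four hq hq0,
    bressoudSum_odd_four hq hq0] at hodd half2 half6 hrefl hrefl' ⊢
  linear_combination hodd + half2 + hrefl - q ^ (m + 3) * half6 - q ^ (m + 2) * hrefl'

end Evaluations

/-! ### Weighted sums -/

/-- The sum `∑_{n + r = N} q^(r²) [N; r]_q W(q^n, q^r)`, the inner sum of a double series summed
along the antidiagonals `n + r = N`. -/
noncomputable def weightedRogersSum (q : ℂ) (W : ℂ × ℂ → ℂ) (N : ℕ) : ℂ :=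
  ∑ p ∈ antidiagonal N, q ^ p.2 ^ 2 * qBinom q N p.2 * W (q ^ p.1, q ^ p.2)

section Weights

variable {q : ℂ} (hq0 : q ≠ 0)
include hq0

theorem rogersSum_eq_weightedRogersSum (k : ℤ) (N : ℕ) :
    rogersSum q k N = weightedRogersSum q (fun z => z.2 ^ k) N := by
  have hzero : ∀ j ∉ (range (N + 1)).map Nat.castEmbedding,
      q ^ (j ^ 2 + k * j) * qBinom q N (0 + 1 * j) = 0 := fun j hj => by
    rcases lt_or_ge j 0 with h | h
    · rw [qBinom_of_neg _ _ (by omega), mul_zero]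
    · lift j to ℕ using h
      have : N < j := by simpa using hj
      rw [qBinom_of_lt _ (by omega), mul_zero]
  rw [rogersSum, qBinomSum, tsum_eq_sum hzero, sum_map, weightedRogersSum,
    ← Nat.sum_antidiagonal_swap, Nat.sum_antidiagonal_eq_sum_range_succ_mk]
  refine sum_congr rfl fun r _ => ?_
  simp only [Nat.castEmbedding_apply, Prod.snd_swap, zero_add, one_mul]
  rw [zpow_add₀ hq0, mul_comm k, zpow_mul, zpow_natCast, ← Nat.cast_pow, zpow_natCast]
  ring

/-- On `n + r = N` one has `q^n = q^N (q^r)⁻¹`, so a weight polynomial in `q^n` and `q^r` is a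
Laurent polynomial in `q^r`. -/
theorem weightedRogersSum_eq_sum {ι : Type*} [Fintype ι] {W : ℂ × ℂ → ℂ} {N : ℕ} (a : ι → ℂ)
    (k : ι → ℤ) (hW : ∀ n r, n + r = N → W (q ^ n, q ^ r) = ∑ i, a i * (q ^ r) ^ k i) :
    weightedRogersSum q W N = ∑ i, a i * rogersSum q (k i) N := by
  simp only [rogersSum_eq_weightedRogersSum hq0, weightedRogersSum, mul_sum]
  rw [sum_comm]
  refine sum_congr rfl fun p hp => ?_
  rw [hW p.1 p.2 (mem_antidiagonal.mp hp), mul_sum]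
  exact sum_congr rfl fun i _ => by ring

end Weights

/-! ### Durfee rectangles and the Bailey limit -/

section Convergence

theorem tendsto_qPoch (a : ℂ) {q : ℂ} (hq : ‖q‖ < 1) :
    Tendsto (qPoch a q) atTop (𝓝 (qPochInf a q)) :=
  (multipliable_qPochInf a hq).tendsto_prod_tprod_nat

variable {q : ℂ} (hq : ‖q‖ < 1)
include hq

theorem pow_succ_ne_one (m : ℕ) : q ^ (m + 1) ≠ 1 := fun h => by
  have hlt := pow_lt_one₀ (norm_nonneg q) hq m.succ_ne_zero
  rw [← norm_pow, h, norm_one] at hlt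
  exact lt_irrefl 1 hlt

theorem qPochInf_self_ne_zero : qPochInf q q ≠ 0 := by
  have h := tprod_one_add_ne_zero_of_summable (f := fun j : ℕ => -(q * q ^ j)) (fun j => by
    rw [← sub_eq_add_neg, ← pow_succ']
    exact sub_ne_zero.mpr (pow_succ_ne_one hq j).symm)
    ((summable_geometric_of_norm_lt_one hq).mul_left q).neg.norm
  simpa only [qPochInf, ← sub_eq_add_neg] using h

theorem tendsto_inv_qPoch :
    Tendsto (fun m => (qPoch q q m)⁻¹) atTop (𝓝 (qPochInf q q)⁻¹) :=
  (tendsto_qPoch q hq).inv₀ (qPochInf_self_ne_zero hq)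

theorem tendsto_qPochInv : Tendsto (qPochInv q) atTop (𝓝 (qPochInf q q)⁻¹) := by
  have htoNat : Tendsto Int.toNat atTop atTop :=
    tendsto_atTop.mpr fun b => (eventually_ge_atTop (b : ℤ)).mono fun k hk => by omega
  refine ((tendsto_inv_qPoch hq).comp htoNat).congr' ?_
  filter_upwards [eventually_ge_atTop 0] with k hk
  rw [qPochInv, if_neg hk.not_gt, Function.comp_apply]

theorem exists_norm_qPoch_le : ∃ B, ∀ m, ‖qPoch q q m‖ ≤ B := by
  obtain ⟨B, hB⟩ := (Metric.isBounded_range_of_tendsto _ (tendsto_qPoch q hq)).exists_norm_le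
  exact ⟨B, fun m => hB _ ⟨m, rfl⟩⟩

theorem exists_norm_inv_qPoch_le : ∃ C, ∀ m, ‖(qPoch q q m)⁻¹‖ ≤ C := by
  obtain ⟨C, hC⟩ := (Metric.isBounded_range_of_tendsto _ (tendsto_inv_qPoch hq)).exists_norm_le
  exact ⟨C, fun m => hC _ ⟨m, rfl⟩⟩

theorem exists_norm_qPochInv_le : ∃ C, ∀ k, ‖qPochInv q k‖ ≤ C := by
  obtain ⟨C, hC⟩ := exists_norm_inv_qPoch_le hq
  refine ⟨C, fun k => ?_⟩
  rw [qPochInv]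
  split_ifs
  · rw [norm_zero]
    exact (norm_nonneg _).trans (hC 0)
  · exact hC _

theorem exists_norm_qBinom_le : ∃ B, ∀ M k, ‖qBinom q M k‖ ≤ B := by
  obtain ⟨B, hB⟩ := exists_norm_qPoch_le hq
  obtain ⟨C, hC⟩ := exists_norm_qPochInv_le hq
  have hB0 : 0 ≤ B := (norm_nonneg _).trans (hB 0)
  have hC0 : 0 ≤ C := (norm_nonneg _).trans (hC 0)
  refine ⟨B * C * C, fun M k => ?_⟩
  rw [qBinom, norm_mul, norm_mul]
  have hM := hB M
  have hk := hC k
  have hMk := hC (M - k)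
  gcongr

theorem tendsto_qBinom_central (j : ℤ) :
    Tendsto (fun N : ℕ => qBinom q (2 * N) (N + j)) atTop (𝓝 (qPochInf q q)⁻¹) := by
  have hnum : Tendsto (fun N : ℕ => qPoch q q (2 * N)) atTop (𝓝 (qPochInf q q)) :=
    (tendsto_qPoch q hq).comp (tendsto_id.const_mul_atTop' two_pos)
  have hden (i : ℤ) : Tendsto (fun N : ℕ => qPochInv q (N + i)) atTop (𝓝 (qPochInf q q)⁻¹) :=
    (tendsto_qPochInv hq).comp (tendsto_atTop_add_const_right _ i tendsto_natCast_atTop_atTop)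
  have hlim := (hnum.mul (hden j)).mul (hden (-j))
  rw [mul_inv_cancel₀ (qPochInf_self_ne_zero hq), one_mul] at hlim
  refine hlim.congr fun N => ?_
  rw [qBinom, show ((2 * N : ℕ) : ℤ) - (N + j) = N + -j by push_cast; ring]

theorem norm_pow_mul_le {e e' : ℕ} (he : e ≤ e') {x : ℂ} {C : ℝ} (hx : ‖x‖ ≤ C) :
    ‖q ^ e' * x‖ ≤ ‖q‖ ^ e * C := by
  rw [norm_mul, norm_pow]
  have hpow := pow_le_pow_of_le_one (norm_nonneg q) hq.le he
  gcongr

end Convergence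

/-- The general term of the sum over Durfee rectangles with side lengths `m` and `m + l`. -/
noncomputable def durfeeTerm (q : ℂ) (l m : ℕ) : ℂ :=
  q ^ (m ^ 2 + l * m) * ((qPoch q q m)⁻¹ * (qPoch q q (m + l))⁻¹)

theorem durfeeTerm_zero_right {q : ℂ} (hq : ∀ m : ℕ, q ^ (m + 1) ≠ 1) (l : ℕ) :
    durfeeTerm q l 0 = (1 - q ^ (l + 1)) * durfeeTerm q (l + 1) 0 := by
  have hl : 1 - q ^ (l + 1) ≠ 0 := sub_ne_zero.mpr (hq l).symm
  simp only [durfeeTerm, zero_add, qPoch_self_succ, mul_inv]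
  field_simp
  simp

theorem durfeeTerm_succ_right {q : ℂ} (hq : ∀ m : ℕ, q ^ (m + 1) ≠ 1) (l m : ℕ) :
    durfeeTerm q l (m + 1) =
      (1 - q ^ (l + 1)) * durfeeTerm q (l + 1) (m + 1) + q ^ (l + 1) * durfeeTerm q (l + 2) m := by
  have hm : 1 - q ^ (m + 1) ≠ 0 := sub_ne_zero.mpr (hq m).symm
  have hml : 1 - q ^ (m + l + 1 + 1) ≠ 0 := sub_ne_zero.mpr (hq _).symm
  have hP := qPoch_self_ne_zero hq m
  have hP' := qPoch_self_ne_zero hq (m + l + 1)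
  rw [durfeeTerm, durfeeTerm, durfeeTerm, show m + 1 + l = m + l + 1 by ring,
    show m + 1 + (l + 1) = m + l + 1 + 1 by ring, show m + (l + 2) = m + l + 1 + 1 by ring,
    qPoch_self_succ q m, qPoch_self_succ q (m + l + 1)]
  field_simp
  ring

section Durfee

variable {q : ℂ} (hq : ‖q‖ < 1)
include hq

theorem exists_norm_durfeeTerm_le :
    ∃ C, ∀ l m e, e ≤ m ^ 2 + l * m → ‖durfeeTerm q l m‖ ≤ ‖q‖ ^ e * C := by
  obtain ⟨C, hC⟩ := exists_norm_inv_qPoch_le hq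
  refine ⟨C * C, fun l m e he => norm_pow_mul_le hq he ?_⟩
  rw [norm_mul]
  exact mul_le_mul (hC _) (hC _) (norm_nonneg _) ((norm_nonneg _).trans (hC 0))

theorem summable_durfeeTerm (l : ℕ) : Summable (durfeeTerm q l) := by
  obtain ⟨C, hC⟩ := exists_norm_durfeeTerm_le hq
  exact Summable.of_norm_bounded
    ((summable_geometric_of_lt_one (norm_nonneg q) hq).mul_right C) fun m =>
      hC l m m (le_add_right (Nat.le_self_pow two_ne_zero m))

theorem tsum_durfeeTerm_recurrence (l : ℕ) : ∑' m, durfeeTerm q l m =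
    (1 - q ^ (l + 1)) * ∑' m, durfeeTerm q (l + 1) m +
      q ^ (l + 1) * ∑' m, durfeeTerm q (l + 2) m := by
  have hne := pow_succ_ne_one hq
  have htail (l : ℕ) : Summable fun m => durfeeTerm q l (m + 1) :=
    (summable_nat_add_iff 1).mpr (summable_durfeeTerm hq l)
  rw [(summable_durfeeTerm hq l).tsum_eq_zero_add,
    (summable_durfeeTerm hq (l + 1)).tsum_eq_zero_add, durfeeTerm_zero_right hne,
    tsum_congr (durfeeTerm_succ_right hne l),
    ((htail (l + 1)).mul_left _).tsum_add ((summable_durfeeTerm hq (l + 2)).mul_left _),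
    tsum_mul_left, tsum_mul_left]
  ring

theorem tendsto_tsum_durfeeTerm :
    Tendsto (fun l => ∑' m, durfeeTerm q l m) atTop (𝓝 (qPochInf q q)⁻¹) := by
  obtain ⟨C, hC⟩ := exists_norm_durfeeTerm_le hq
  have hgeom := summable_geometric_of_lt_one (norm_nonneg q) hq
  have hlim := tendsto_tsum_of_dominated_convergence (𝓕 := atTop) (f := durfeeTerm q)
    (g := fun m => if m = 0 then (qPochInf q q)⁻¹ else 0) (hgeom.mul_right C) (fun m => ?_)
    (Eventually.of_forall fun l m => hC l m m (le_add_right (Nat.le_self_pow two_ne_zero m)))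
  · rwa [tsum_ite_eq] at hlim
  rcases m with _ | m
  · simpa [durfeeTerm, qPoch] using tendsto_inv_qPoch hq
  · simp only [Nat.add_eq_zero_iff, one_ne_zero, and_false, if_false]
    refine squeeze_zero_norm (fun l => hC l (m + 1) l (by nlinarith)) ?_
    simpa using (tendsto_pow_atTop_nhds_zero_of_lt_one (norm_nonneg q) hq).mul_const C

theorem tsum_durfeeTerm (l : ℕ) : ∑' m, durfeeTerm q l m = (qPochInf q q)⁻¹ := by
  set D : ℕ → ℂ := fun l => ∑' m, durfeeTerm q l m
  have hlim : Tendsto D atTop (𝓝 (qPochInf q q)⁻¹) := tendsto_tsum_durfeeTerm hq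
  have hdiff (l : ℕ) : D l - D (l + 1) = -q ^ (l + 1) * (D (l + 1) - D (l + 2)) := by
    linear_combination tsum_durfeeTerm_recurrence hq l
  -- The recurrence makes successive differences grow in norm, although they tend to zero.
  have hmono : Monotone fun l => ‖D l - D (l + 1)‖ := by
    refine monotone_nat_of_le_succ fun l => ?_
    rw [hdiff, norm_mul, norm_neg, norm_pow]
    exact mul_le_of_le_one_left (norm_nonneg _) (pow_le_one₀ (norm_nonneg _) hq.le)
  have hzero : Tendsto (fun l => ‖D l - D (l + 1)‖) atTop (𝓝 0) := by
    simpa using (hlim.sub ((tendsto_add_atTop_iff_nat 1).mpr hlim)).norm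
  have hconst (l : ℕ) : D (l + 1) = D l :=
    (sub_eq_zero.mp (norm_le_zero_iff.mp (hmono.ge_of_tendsto hzero l))).symm
  have hall (l : ℕ) : D l = D 0 := Nat.rec rfl (fun l ih => (hconst l).trans ih) l
  refine tendsto_nhds_unique (tendsto_const_nhds.congr fun n => ?_) hlim
  exact (hall l).trans (hall n).symm

theorem hasSum_durfee (k : ℤ) :
    HasSum (fun N : ℕ => q ^ N ^ 2 * (qPochInv q (N - k) * qPochInv q (N + k)))
      (q ^ k ^ 2 / qPochInf q q) := by
  wlog hk : 0 ≤ k generalizing k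
  · have h := this (-k) (by omega)
    simpa only [neg_sq, sub_neg_eq_add, ← sub_eq_add_neg, mul_comm (qPochInv q (_ + _))] using h
  lift k to ℕ using hk
  have h := (summable_durfeeTerm hq (2 * k)).hasSum.mul_left (q ^ k ^ 2)
  rw [tsum_durfeeTerm hq, ← div_eq_mul_inv] at h
  rw [← Nat.cast_pow, zpow_natCast, ← (add_left_injective k).hasSum_iff]
  · refine h.congr_fun fun m => ?_
    rw [Function.comp_apply, Nat.cast_add, add_sub_cancel_right, qPochInv_natCast,
      show (m : ℤ) + k + k = (m + 2 * k : ℕ) by push_cast; ring, qPochInv_natCast, durfeeTerm]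
    ring
  · intro N hN
    have hlt : N < k := not_le.mp fun hle => hN ⟨N - k, Nat.sub_add_cancel hle⟩
    rw [qPochInv_of_neg q (by omega), zero_mul, mul_zero]

theorem hasSum_bailey {ι : Type*} {α : ι → ℂ} (hα : Summable α) (c : ι → ℤ) :
    HasSum (fun N : ℕ => q ^ N ^ 2 * ∑' j, α j * (qPochInv q (N - c j) * qPochInv q (N + c j)))
      ((∑' j, q ^ c j ^ 2 * α j) / qPochInf q q) := by
  obtain ⟨C, hC⟩ := exists_norm_qPochInv_le hq
  have hC0 : 0 ≤ C := (norm_nonneg _).trans (hC 0)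
  set F : ℕ × ι → ℂ := fun p =>
    α p.2 * (q ^ p.1 ^ 2 * (qPochInv q (p.1 - c p.2) * qPochInv q (p.1 + c p.2))) with hF
  have hgeom := summable_geometric_of_lt_one (norm_nonneg q) hq
  have hsum : Summable F := by
    refine Summable.of_norm_bounded ((hgeom.mul_of_nonneg hα.norm (fun _ => by positivity)
      fun _ => by positivity).mul_right (C * C)) ?_
    rintro ⟨N, j⟩
    have hqq : ‖qPochInv q (N - c j) * qPochInv q (N + c j)‖ ≤ C * C := by
      rw [norm_mul]
      exact mul_le_mul (hC _) (hC _) (norm_nonneg _) hC0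
    rw [hF, norm_mul]
    refine (mul_le_mul_of_nonneg_left (norm_pow_mul_le hq
      (Nat.le_self_pow two_ne_zero N) hqq) (norm_nonneg _)).trans_eq ?_
    ring
  have hswap : ∑' p, F p = (∑' j, q ^ c j ^ 2 * α j) / qPochInf q q := by
    rw [hsum.tsum_prod, ← hsum.tsum_comm (f := fun N j => F (N, j)), ← tsum_div_const]
    refine tsum_congr fun j => ?_
    simp only [hF]
    rw [tsum_mul_left, (hasSum_durfee hq (c j)).tsum_eq]
    ring
  rw [← hswap]
  refine (hsum.hasSum.prod_fiberwise fun N => (hsum.prod_factor N).hasSum).congr_fun fun N => ?_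
  rw [← tsum_mul_left]
  exact tsum_congr fun j => mul_left_comm _ _ _

theorem hasSum_qBinomSum {α : ℤ → ℂ} (hα : Summable α) (c d : ℤ) :
    HasSum (fun N : ℕ => q ^ N ^ 2 / qPoch q q (2 * N) * qBinomSum q d (2 * N) (N + c) α)
      ((∑' j, q ^ (c + d * j) ^ 2 * α j) / qPochInf q q) := by
  refine (hasSum_bailey hq hα fun j => c + d * j).congr_fun fun N => ?_
  rw [div_mul_eq_mul_div, mul_div_assoc, qBinomSum, ← tsum_div_const]
  congr 2
  ext j
  have hP := qPoch_self_ne_zero (pow_succ_ne_one hq) (2 * N)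
  rw [qBinom, add_assoc, show ((2 * N : ℕ) : ℤ) - (N + (c + d * j)) = N - (c + d * j) by
    push_cast; ring]
  field_simp

end Durfee

/-! ### Jacobi's triple product -/

theorem thetaTerm_ne_zero {q z : ℂ} (hq0 : q ≠ 0) (hz : z ≠ 0) (j : ℤ) : thetaTerm q z j ≠ 0 :=
  mul_ne_zero (mul_ne_zero (zpow_ne_zero j (neg_ne_zero.mpr one_ne_zero)) (zpow_ne_zero j hz))
    (zpow_ne_zero _ hq0)

theorem summable_thetaTerm_natCast {q z : ℂ} (hq : ‖q‖ < 1) (hq0 : q ≠ 0) (hz : z ≠ 0) :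
    Summable fun n : ℕ => thetaTerm q z n := by
  refine summable_of_ratio_test_tendsto_lt_one zero_lt_one
    (Eventually.of_forall fun n => thetaTerm_ne_zero hq0 hz n) ?_
  have hratio (n : ℕ) : ‖thetaTerm q z (n + 1 : ℕ)‖ / ‖thetaTerm q z n‖ = ‖z‖ * ‖q‖ ^ n := by
    rw [← norm_div, Nat.cast_add_one, thetaTerm_add_one hq0 hz,
      mul_div_cancel_right₀ _ (thetaTerm_ne_zero hq0 hz n), norm_neg, norm_mul, zpow_natCast,
      norm_pow]
  simp only [hratio]
  simpa using (tendsto_pow_atTop_nhds_zero_of_lt_one (norm_nonneg q) hq).const_mul ‖z‖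

theorem summable_thetaTerm {q z : ℂ} (hq : ‖q‖ < 1) (hq0 : q ≠ 0) (hz : z ≠ 0) :
    Summable (thetaTerm q z) := by
  refine Summable.of_nat_of_neg (summable_thetaTerm_natCast hq hq0 hz) ?_
  simpa only [thetaTerm_neg hq0] using summable_thetaTerm_natCast hq hq0 (div_ne_zero hq0 hz)

section FiniteJacobi

variable {q z : ℂ} (hq : ∀ m : ℕ, q ^ (m + 1) ≠ 1) (hq0 : q ≠ 0) (hz : z ≠ 0)
include hq0 hz

theorem qBinomSum_thetaTerm_shift (M : ℕ) (c : ℤ) : qBinomSum q 1 M c (thetaTerm q z) =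
    -z * qBinomSum q 1 M (c + 1) (thetaTerm q (z * q)) := by
  rw [qBinomSum_shift, ← qBinomSum_const_mul]
  simp only [thetaTerm_add_one hq0 hz, ← zpow_mul_thetaTerm, neg_mul, mul_assoc]

include hq

theorem qBinomSum_thetaTerm_succ (M : ℕ) (c : ℤ) : qBinomSum q 1 (M + 1) c (thetaTerm q z) =
    (1 - q ^ c / z) * qBinomSum q 1 M (c - 1) (thetaTerm q z) := by
  have hshift := qBinomSum_thetaTerm_shift hq0 hz M (c - 1)
  rw [sub_add_cancel] at hshift
  simp only [qBinomSum_succ hq hq0 one_ne_zero, zpow_one, zpow_mul_thetaTerm]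
  rw [hshift]
  field_simp
  ring

theorem qBinomSum_thetaTerm_succ' (M : ℕ) (c : ℤ) : qBinomSum q 1 (M + 1) c (thetaTerm q z) =
    (1 - z * q ^ (M - c)) * qBinomSum q 1 M c (thetaTerm q z) := by
  have hshift := qBinomSum_thetaTerm_shift hq0 (mul_ne_zero hz (inv_ne_zero hq0)) M (c - 1)
  rw [sub_add_cancel, inv_mul_cancel_right₀ hq0] at hshift
  simp only [qBinomSum_succ' hq hq0 one_ne_zero, zpow_neg_one, zpow_mul_thetaTerm]
  rw [hshift, add_sub_right_comm, zpow_add_one₀ hq0]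
  field_simp
  ring

theorem qBinomSum_thetaTerm (N : ℕ) :
    qBinomSum q 1 (2 * N) N (thetaTerm q z) = qPoch z q N * qPoch (q / z) q N := by
  induction N with
  | zero => simp [qBinomSum_zero, thetaTerm_zero, qPoch]
  | succ N ih =>
    rw [mul_add_one, qBinomSum_thetaTerm_succ' hq hq0 hz, qBinomSum_thetaTerm_succ hq hq0 hz,
      show ((2 * N + 1 : ℕ) : ℤ) - (N + 1 : ℕ) = N by push_cast; ring,
      show ((N + 1 : ℕ) : ℤ) - 1 = N by push_cast; ring, ih, qPoch_succ, qPoch_succ,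
      zpow_natCast, zpow_natCast]
    ring

end FiniteJacobi

theorem tsum_thetaTerm {q z : ℂ} (hq : ‖q‖ < 1) (hq0 : q ≠ 0) (hz : z ≠ 0) :
    ∑' j, thetaTerm q z j = qPochInf₃ z (q / z) q q := by
  obtain ⟨B, hB⟩ := exists_norm_qBinom_le hq
  have hsum := summable_thetaTerm hq hq0 hz
  have hlim := tendsto_tsum_of_dominated_convergence (𝓕 := atTop)
    (f := fun (N : ℕ) j => thetaTerm q z j * qBinom q (2 * N) (N + 1 * j))
    (hsum.norm.mul_right B)
    (fun j => by simpa only [one_mul] using (tendsto_qBinom_central hq j).const_mul _)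
    (Eventually.of_forall fun N j => by
      rw [norm_mul]
      exact mul_le_mul_of_nonneg_left (hB _ _) (norm_nonneg _))
  have hprod := (tendsto_qPoch z hq).mul (tendsto_qPoch (q / z) hq)
  simp only [← qBinomSum_thetaTerm (pow_succ_ne_one hq) hq0 hz] at hprod
  have heq := tendsto_nhds_unique hlim hprod
  rw [tsum_mul_right] at heq
  rw [qPochInf₃, ← heq, inv_mul_cancel_right₀ (qPochInf_self_ne_zero hq)]

theorem zpow_sq_mul_thetaTerm {q : ℂ} (hq0 : q ≠ 0) (b c j : ℤ) :
    q ^ (c + 2 * j) ^ 2 * thetaTerm (q ^ 5) (q ^ b) j =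
      q ^ c ^ 2 * thetaTerm (q ^ 13) (q ^ (b + 4 + 4 * c)) j := by
  have hpow (d b : ℤ) : thetaTerm (q ^ d) (q ^ b) j =
      (-1) ^ j * q ^ (b * j + d * Ring.choose j 2) := by
    rw [thetaTerm, zpow_add₀ hq0, zpow_mul, zpow_mul, mul_assoc]
  rw [← zpow_ofNat, ← zpow_ofNat q 13, hpow, hpow, mul_left_comm, ← zpow_add₀ hq0, mul_left_comm,
    ← zpow_add₀ hq0]
  congr 2
  linear_combination -4 * two_mul_choose_two j

/-- Adding the quadratic exponent `4j²` supplied by the Bailey limit to the exponent `5j²/2` of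
the Bressoud sums yields `13j²/2`, whence the modulus `13`. -/
theorem hasSum_bressoudSum {q : ℂ} (hq : ‖q‖ < 1) (hq0 : q ≠ 0) (b c : ℤ) :
    HasSum (fun N : ℕ => q ^ N ^ 2 / qPoch q q (2 * N) * bressoudSum q (2 * N) (N + c) b)
      (q ^ c ^ 2 * (qPochInf₃ (q ^ (9 - b - 4 * c)) (q ^ (b + 4 + 4 * c)) (q ^ 13) (q ^ 13) /
        qPochInf q q)) := by
  have hnorm (n : ℕ) (hn : n ≠ 0) : ‖q ^ n‖ < 1 := by
    rw [norm_pow]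
    exact pow_lt_one₀ (norm_nonneg q) hq hn
  have hz (b : ℤ) : q ^ b ≠ 0 := zpow_ne_zero b hq0
  have h := hasSum_qBinomSum hq
    (summable_thetaTerm (hnorm 5 (by norm_num)) (pow_ne_zero 5 hq0) (hz b)) c 2
  simp only [zpow_sq_mul_thetaTerm hq0, tsum_mul_left, mul_div_assoc,
    tsum_thetaTerm (hnorm 13 (by norm_num)) (pow_ne_zero 13 hq0) (hz (b + 4 + 4 * c))] at h
  rwa [qPochInf₃, mul_comm (qPochInf _ _), ← zpow_ofNat q 13, ← zpow_sub₀ hq0,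
    show 13 - (b + 4 + 4 * c) = 9 - b - 4 * c by ring, zpow_ofNat, ← qPochInf₃] at h

theorem hasSum_bressoudSum_even {q : ℂ} (hq : ‖q‖ < 1) (hq0 : q ≠ 0) (b : ℤ) :
    HasSum (fun N : ℕ => q ^ N ^ 2 / qPoch q q (2 * N) * bressoudSum q (2 * N) N b)
      (qPochInf₃ (q ^ (9 - b)) (q ^ (b + 4)) (q ^ 13) (q ^ 13) / qPochInf q q) := by
  simpa using hasSum_bressoudSum hq hq0 b 0

theorem hasSum_bressoudSum_odd {q : ℂ} (hq : ‖q‖ < 1) (hq0 : q ≠ 0) (b : ℤ) :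
    HasSum (fun N : ℕ => q ^ N ^ 2 * (q ^ (2 * N) / qPoch q q (2 * (N + 1)) *
        bressoudSum q (2 * (N + 1)) ((N + 1 : ℕ) + 1) b))
      (qPochInf₃ (q ^ (5 - b)) (q ^ (b + 8)) (q ^ 13) (q ^ 13) / qPochInf q q) := by
  have h := (hasSum_nat_add_iff' 1).mpr (hasSum_bressoudSum hq hq0 b 1)
  have hpow : 9 - b - 4 * 1 = 5 - b ∧ b + 4 + 4 * 1 = b + 8 := ⟨by ring, by ring⟩
  rw [hpow.1, hpow.2, sum_range_one, Nat.cast_zero, zero_add, mul_zero, bressoudSum_zero_one,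
    mul_zero, sub_zero, one_pow, zpow_one] at h
  rw [← inv_mul_cancel_left₀ hq0 (_ / _)]
  refine (h.mul_left q⁻¹).congr_fun fun N => ?_
  field_simp
  ring

/-! ### Summation along antidiagonals -/

theorem hasSum_of_hasSum_antidiagonal {M : Type*} [AddCommMonoid M] [TopologicalSpace M]
    [ContinuousAdd M] [T3Space M] {f : ℕ × ℕ → M} (hf : Summable f) {S : M}
    (h : HasSum (fun N => ∑ p ∈ antidiagonal N, f p) S) : HasSum f S := by
  have hsigma := (HasAntidiagonal.sigmaAntidiagonalEquivProd (A := ℕ)).hasSum_iff.mpr hf.hasSum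
  rw [← (hsigma.sigma fun N => Finset.hasSum (antidiagonal N) f).unique h]
  exact hf.hasSum

section DoubleSums

variable {q : ℂ} (hq : ‖q‖ < 1)
include hq

theorem summable_mul_qBinom_mul {u : ℕ → ℂ} (hu : ∃ U, ∀ N, ‖u N‖ ≤ U) {W : ℂ × ℂ → ℂ}
    (hW : Continuous W) :
    Summable fun p : ℕ × ℕ => q ^ (p.1 + p.2) ^ 2 * (u (p.1 + p.2) *
      (q ^ p.2 ^ 2 * qBinom q (p.1 + p.2) p.2 * W (q ^ p.1, q ^ p.2))) := by
  obtain ⟨U, hU⟩ := hu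
  obtain ⟨B, hB⟩ := exists_norm_qBinom_le hq
  obtain ⟨K, hK⟩ := ((isCompact_closedBall (0 : ℂ) 1).prod
    (isCompact_closedBall (0 : ℂ) 1)).exists_bound_of_continuousOn hW.continuousOn
  have hU0 : 0 ≤ U := (norm_nonneg _).trans (hU 0)
  have hB0 : 0 ≤ B := (norm_nonneg _).trans (hB 0 0)
  have hpow (n : ℕ) : ‖q ^ n‖ ≤ 1 := by
    rw [norm_pow]
    exact pow_le_one₀ (norm_nonneg _) hq.le
  have hgeom := summable_geometric_of_lt_one (norm_nonneg q) hq
  refine Summable.of_norm_bounded ((hgeom.mul_of_nonneg hgeom (fun _ => by positivity)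
    fun _ => by positivity).mul_right (U * (1 * B * K))) ?_
  rintro ⟨n, r⟩
  rw [← pow_add]
  refine norm_pow_mul_le hq (Nat.le_self_pow two_ne_zero (n + r)) ?_
  have hWK := hK (q ^ n, q ^ r) (by
    simpa only [Set.mem_prod, mem_closedBall_zero_iff] using ⟨hpow n, hpow r⟩)
  have hUN := hU (n + r)
  have hBN := hB (n + r) r
  have hr := hpow (r ^ 2)
  rw [norm_mul, norm_mul, norm_mul]
  gcongr

theorem hasSum_of_weightedRogersSum {u : ℕ → ℂ} (hu : ∃ U, ∀ N, ‖u N‖ ≤ U) {W : ℂ × ℂ → ℂ}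
    (hW : Continuous W) {S : ℂ}
    (h : HasSum (fun N => q ^ N ^ 2 * (u N * weightedRogersSum q W N)) S) :
    HasSum (fun p : ℕ × ℕ => q ^ (p.1 + p.2) ^ 2 * (u (p.1 + p.2) *
      (q ^ p.2 ^ 2 * qBinom q (p.1 + p.2) p.2 * W (q ^ p.1, q ^ p.2)))) S := by
  refine hasSum_of_hasSum_antidiagonal (summable_mul_qBinom_mul hq hu hW) (h.congr_fun fun N => ?_)
  rw [weightedRogersSum, mul_sum, mul_sum]
  refine sum_congr rfl fun p hp => ?_
  rw [mem_antidiagonal.mp hp]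

end DoubleSums

/-- The general term of the double series over `(n, r)` with exponent `n² + 2r² + 2nr`; the weight
`W` is a function of `q^n` and `q^r`. -/
noncomputable def evenTerm (q : ℂ) (W : ℂ × ℂ → ℂ) (p : ℕ × ℕ) : ℂ :=
  q ^ (p.1 ^ 2 + 2 * p.2 ^ 2 + 2 * p.1 * p.2) * qPoch q q (p.1 + p.2) /
    (qPoch q q (2 * p.1 + 2 * p.2) * qPoch q q p.2 * qPoch q q p.1) * W (q ^ p.1, q ^ p.2)

/-- The general term of the double series over `(n, r)` with exponent `n² + 2r² + 2nr + 2n + 3r`;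
the weight `W` is a function of `q^n` and `q^r`. -/
noncomputable def oddTerm (q : ℂ) (W : ℂ × ℂ → ℂ) (p : ℕ × ℕ) : ℂ :=
  q ^ (p.1 ^ 2 + 2 * p.2 ^ 2 + 2 * p.1 * p.2 + 2 * p.1 + 3 * p.2) * qPoch q q (p.1 + p.2 + 1) /
    (qPoch q q (2 * p.1 + 2 * p.2 + 2) * qPoch q q p.2 * qPoch q q p.1) * W (q ^ p.1, q ^ p.2)

theorem hasSum_evenTerm {q : ℂ} (hq : ‖q‖ < 1) (hq0 : q ≠ 0) {W : ℂ × ℂ → ℂ} (hW : Continuous W)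
    {b : ℤ} {i k : ℕ} (hi : i = 9 - b) (hk : k = b + 4)
    (h : ∀ N, weightedRogersSum q W N = bressoudSum q (2 * N) N b) :
    HasSum (evenTerm q W)
      (qPochInf₃ (q ^ i) (q ^ k) (q ^ 13) (q ^ 13) / qPochInf q q) := by
  have hsum := hasSum_bressoudSum_even hq hq0 b
  simp only [← hi, ← hk, zpow_natCast, ← h, div_eq_mul_inv (q ^ _), mul_assoc] at hsum
  obtain ⟨C, hC⟩ := exists_norm_inv_qPoch_le hq
  refine (hasSum_of_weightedRogersSum hq ⟨C, fun N => hC (2 * N)⟩ hW hsum).congr_fun fun p => ?_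
  rw [evenTerm, qBinom_add, ← mul_add]
  ring

theorem hasSum_oddTerm {q : ℂ} (hq : ‖q‖ < 1) (hq0 : q ≠ 0) {W : ℂ × ℂ → ℂ} (hW : Continuous W)
    {b : ℤ} {i k : ℕ} (hi : i = 5 - b) (hk : k = b + 8)
    (h : ∀ N, (1 - q ^ (N + 1)) * weightedRogersSum q (fun z => z.2 * W z) N =
      bressoudSum q (2 * (N + 1)) ((N + 1 : ℕ) + 1) b) :
    HasSum (oddTerm q W)
      (qPochInf₃ (q ^ i) (q ^ k) (q ^ 13) (q ^ 13) / qPochInf q q) := by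
  have hsum := hasSum_bressoudSum_odd hq hq0 b
  simp only [← hi, ← hk, zpow_natCast, ← h, ← mul_assoc (_ / _)] at hsum
  obtain ⟨C, hC⟩ := exists_norm_inv_qPoch_le hq
  have hbound (N : ℕ) :
      ‖q ^ (2 * N) / qPoch q q (2 * (N + 1)) * (1 - q ^ (N + 1))‖ ≤ 1 * C * (1 + 1) := by
    have hpow (n : ℕ) : ‖q ^ n‖ ≤ 1 := by
      rw [norm_pow]
      exact pow_le_one₀ (norm_nonneg _) hq.le
    have hinv := hC (2 * (N + 1))
    have hsub := (norm_sub_le 1 (q ^ (N + 1))).trans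
      (add_le_add norm_one.le (hpow (N + 1)))
    rw [norm_mul, div_eq_mul_inv, norm_mul]
    have h2N := hpow (2 * N)
    have hC0 := (norm_nonneg _).trans hinv
    gcongr
  have hW' : Continuous fun z : ℂ × ℂ => z.2 * W z := continuous_snd.mul hW
  refine (hasSum_of_weightedRogersSum hq ⟨_, hbound⟩ hW' hsum).congr_fun fun p => ?_
  rw [oddTerm, qBinom_add, qPoch_self_succ,
    show 2 * p.1 + 2 * p.2 + 2 = 2 * (p.1 + p.2 + 1) by ring]
  ring

theorem qPochInf₃_zero_pow_div {i k : ℕ} (hi : i ≠ 0) (hk : k ≠ 0) :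
    qPochInf₃ ((0 : ℂ) ^ i) (0 ^ k) (0 ^ 13) (0 ^ 13) / qPochInf 0 0 = 1 := by
  simp [qPochInf₃, qPochInf, hi, hk]

theorem hasSum_evenTerm_zero {W : ℂ × ℂ → ℂ} (hW : W (1, 1) = 1) : HasSum (evenTerm 0 W) 1 := by
  have h0 : evenTerm 0 W (0, 0) = 1 := by simp [evenTerm, qPoch, hW]
  rw [← h0]
  refine hasSum_single _ fun p hp => ?_
  have hexp : p.1 ^ 2 + 2 * p.2 ^ 2 + 2 * p.1 * p.2 ≠ 0 := fun h => hp (by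
    simp_all [Prod.ext_iff])
  rw [evenTerm, zero_pow hexp, zero_mul, zero_div, zero_mul]

theorem hasSum_oddTerm_zero {W : ℂ × ℂ → ℂ} (hW : W (1, 1) = 1) : HasSum (oddTerm 0 W) 1 := by
  have h0 : oddTerm 0 W (0, 0) = 1 := by simp [oddTerm, qPoch, hW]
  rw [← h0]
  refine hasSum_single _ fun p hp => ?_
  have hexp : p.1 ^ 2 + 2 * p.2 ^ 2 + 2 * p.1 * p.2 + 2 * p.1 + 3 * p.2 ≠ 0 := fun h => hp (by
    simp_all [Prod.ext_iff])
  rw [oddTerm, zero_pow hexp, zero_mul, zero_div, zero_mul]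

/-! ### The six identities modulo 13 -/

theorem hasSum_oddTerm_one_twelve {q : ℂ} (hq : ‖q‖ < 1) :
    HasSum (oddTerm q fun _ => 1)
      (qPochInf₃ (q ^ 1) (q ^ 12) (q ^ 13) (q ^ 13) / qPochInf q q) := by
  rcases eq_or_ne q 0 with rfl | hq0
  · rw [qPochInf₃_zero_pow_div (by norm_num) (by norm_num)]
    exact hasSum_oddTerm_zero rfl
  refine hasSum_oddTerm hq hq0 continuous_const (b := 4) (by norm_num) (by norm_num) fun N => ?_
  rw [bressoudSum_odd_succ_four (pow_succ_ne_one hq) hq0,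
    weightedRogersSum_eq_sum hq0 ![1] ![1] fun n r _ => by simp]
  simp only [Fin.sum_univ_one, Matrix.cons_val, one_mul]

theorem hasSum_oddTerm_two_eleven {q : ℂ} (hq : ‖q‖ < 1) :
    HasSum (oddTerm q fun z => 1 + q * z.2 + q * z.1 - q * (z.1 * z.2))
      (qPochInf₃ (q ^ 2) (q ^ 11) (q ^ 13) (q ^ 13) / qPochInf q q) := by
  rcases eq_or_ne q 0 with rfl | hq0
  · rw [qPochInf₃_zero_pow_div (by norm_num) (by norm_num)]
    exact hasSum_oddTerm_zero (by norm_num)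
  refine hasSum_oddTerm hq hq0 (by fun_prop) (b := 3) (by norm_num) (by norm_num) fun N => ?_
  have htwo := mul_rogersSum_two (pow_succ_ne_one hq) hq0 N
  rw [bressoudSum_odd_succ_three (pow_succ_ne_one hq) hq0,
    weightedRogersSum_eq_sum hq0 ![1 - q ^ (N + 1), q, q ^ (N + 1)] ![1, 2, 0] fun n r hN => by
      simp only [Fin.sum_univ_three, Matrix.cons_val, zpow_ofNat, ← hN]
      ring]
  simp only [Fin.sum_univ_three, Matrix.cons_val]
  linear_combination (1 - q ^ (N + 1)) * htwo

theorem hasSum_oddTerm_three_ten {q : ℂ} (hq : ‖q‖ < 1) :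
    HasSum (oddTerm q fun z => (1 - q * (z.1 * z.2)) * (z.2 + z.1) * (1 + q) - z.1 * z.2 +
        q ^ 2 * z.2 ^ 2 + q ^ 2 * z.1 ^ 2 + q * (z.1 * z.2) ^ 2 + q ^ 2 * (z.1 * z.2))
      (qPochInf₃ (q ^ 3) (q ^ 10) (q ^ 13) (q ^ 13) / qPochInf q q) := by
  rcases eq_or_ne q 0 with rfl | hq0
  · rw [qPochInf₃_zero_pow_div (by norm_num) (by norm_num)]
    exact hasSum_oddTerm_zero (by norm_num)
  refine hasSum_oddTerm hq hq0 (by fun_prop) (b := 2) (by norm_num) (by norm_num) fun N => ?_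
  have hne := pow_succ_ne_one hq
  have hneg := rogersSum_neg_one hne hq0 N
  have htwo := mul_rogersSum_two hne hq0 N
  have hthree := sq_mul_rogersSum_three hne hq0 N
  rw [bressoudSum_odd_succ_two hne hq0, weightedRogersSum_eq_sum hq0
    ![q ^ 2 * (q ^ N) ^ 2, (1 - q ^ (N + 1)) * (1 + q) * q ^ N,
      -q ^ N + q * (q ^ N) ^ 2 + q ^ 2 * q ^ N, (1 - q ^ (N + 1)) * (1 + q), q ^ 2]
    ![-1, 0, 1, 2, 3] fun n r hN => by
      have hr : q ^ r ≠ 0 := pow_ne_zero r hq0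
      simp only [Fin.sum_univ_five, Matrix.cons_val, zpow_neg_one, zpow_ofNat, ← hN]
      field_simp
      ring]
  simp only [Fin.sum_univ_five, Matrix.cons_val]
  linear_combination (1 - q ^ (N + 1)) * (q ^ 2 * (q ^ N) ^ 2 * hneg + hthree + (1 - q ^ N) * htwo)

theorem hasSum_evenTerm_four_nine {q : ℂ} (hq : ‖q‖ < 1) (hq0 : q ≠ 0) :
    HasSum (evenTerm q fun z => q⁻¹ * (z.2 - 1 + q * z.2 ^ 2 + q * (z.1 * z.2) - z.1 * z.2 ^ 2 +
        z.1 + q * z.1 ^ 2 - z.1 ^ 2 * z.2 - q * (z.1 * z.2 ^ 2) - q * (z.1 ^ 2 * z.2) +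
        (z.1 * z.2) ^ 2))
      (qPochInf₃ (q ^ 4) (q ^ 9) (q ^ 13) (q ^ 13) / qPochInf q q) := by
  refine hasSum_evenTerm hq hq0 (by fun_prop) (b := 5) (by norm_num) (by norm_num) fun N => ?_
  have hne := pow_succ_ne_one hq
  have hneg := rogersSum_neg_one hne hq0 N
  have hneg_two := mul_rogersSum_neg_two hne hq0 N
  have htwo := mul_rogersSum_two hne hq0 N
  refine mul_left_cancel₀ hq0 ?_
  rw [mul_bressoudSum_even_five hne hq0, weightedRogersSum_eq_sum hq0
    ![(q ^ N) ^ 2, q⁻¹ * (q ^ N - (q ^ N) ^ 2 - q * (q ^ N) ^ 2),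
      q⁻¹ * (-1 + q * q ^ N + (q ^ N) ^ 2), q⁻¹ * (1 - q ^ N - q * q ^ N), 1]
    ![-2, -1, 0, 1, 2] fun n r hN => by
      have hr : q ^ r ≠ 0 := pow_ne_zero r hq0
      simp only [Fin.sum_univ_five, Matrix.cons_val, zpow_neg, zpow_ofNat, ← hN]
      field_simp
      ring]
  simp only [Fin.sum_univ_five, Matrix.cons_val, mul_add, ← mul_assoc, mul_inv_cancel₀ hq0, one_mul]
  linear_combination (q ^ N) ^ 2 * hneg_two + (q ^ N - (q ^ N) ^ 2 - (q ^ N) ^ 3) * hneg + htwo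

theorem hasSum_evenTerm_five_eight {q : ℂ} (hq : ‖q‖ < 1) :
    HasSum (evenTerm q fun z => z.1 + z.2 - z.1 * z.2)
      (qPochInf₃ (q ^ 5) (q ^ 8) (q ^ 13) (q ^ 13) / qPochInf q q) := by
  rcases eq_or_ne q 0 with rfl | hq0
  · rw [qPochInf₃_zero_pow_div (by norm_num) (by norm_num)]
    exact hasSum_evenTerm_zero (by norm_num)
  refine hasSum_evenTerm hq hq0 (by fun_prop) (b := 4) (by norm_num) (by norm_num) fun N => ?_
  have hneg := rogersSum_neg_one (pow_succ_ne_one hq) hq0 N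
  rw [bressoudSum_even_four (pow_succ_ne_one hq) hq0,
    weightedRogersSum_eq_sum hq0 ![q ^ N, -q ^ N, 1] ![-1, 0, 1] fun n r hN => by
      have hr : q ^ r ≠ 0 := pow_ne_zero r hq0
      simp only [Fin.sum_univ_three, Matrix.cons_val, zpow_neg_one, zpow_one, zpow_zero, ← hN]
      field_simp
      ring]
  simp only [Fin.sum_univ_three, Matrix.cons_val]
  linear_combination q ^ N * hneg

theorem hasSum_evenTerm_six_seven {q : ℂ} (hq : ‖q‖ < 1) :
    HasSum (evenTerm q fun _ => 1)
      (qPochInf₃ (q ^ 6) (q ^ 7) (q ^ 13) (q ^ 13) / qPochInf q q) := by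
  rcases eq_or_ne q 0 with rfl | hq0
  · rw [qPochInf₃_zero_pow_div (by norm_num) (by norm_num)]
    exact hasSum_evenTerm_zero rfl
  refine hasSum_evenTerm hq hq0 continuous_const (b := 3) (by norm_num) (by norm_num) fun N => ?_
  rw [bressoudSum_even_three (pow_succ_ne_one hq) hq0,
    weightedRogersSum_eq_sum hq0 ![1] ![0] fun n r _ => by simp]
  simp only [Fin.sum_univ_one, Matrix.cons_val, one_mul]

end QSeries

theorem mainTheorem10 (q : ℂ) (hq : ‖q‖ < 1) :
    HasSum
      (fun p : ℕ × ℕ => let n := p.1; let r := p.2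
        q ^ (n ^ 2 + 2 * r ^ 2 + 2 * n * r + 2 * n + 3 * r) * QSeries.qPoch q q (n + r + 1) /
          (QSeries.qPoch q q (2 * n + 2 * r + 2) * QSeries.qPoch q q r * QSeries.qPoch q q n))
      (QSeries.qPochInf₃ (q ^ 1) (q ^ 12) (q ^ 13) (q ^ 13) / QSeries.qPochInf q q) ∧
    HasSum
      (fun p : ℕ × ℕ => let n := p.1; let r := p.2
        q ^ (n ^ 2 + 2 * r ^ 2 + 2 * n * r + 2 * n + 3 * r) * QSeries.qPoch q q (n + r + 1) *
          (1 + q ^ (r + 1) + q ^ (n + 1) - q ^ (n + r + 1)) /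
          (QSeries.qPoch q q (2 * n + 2 * r + 2) * QSeries.qPoch q q r * QSeries.qPoch q q n))
      (QSeries.qPochInf₃ (q ^ 2) (q ^ 11) (q ^ 13) (q ^ 13) / QSeries.qPochInf q q) ∧
    HasSum
      (fun p : ℕ × ℕ => let n := p.1; let r := p.2
        q ^ (n ^ 2 + 2 * r ^ 2 + 2 * n * r + 2 * n + 3 * r) * QSeries.qPoch q q (n + r + 1) /
          (QSeries.qPoch q q (2 * n + 2 * r + 2) * QSeries.qPoch q q r * QSeries.qPoch q q n) *
          ((1 - q ^ (n + r + 1)) * (q ^ r + q ^ n) * (1 + q) - q ^ (n + r) + q ^ (2 * r + 2)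
            + q ^ (2 * n + 2) + q ^ (2 * n + 2 * r + 1) + q ^ (n + r + 2)))
      (QSeries.qPochInf₃ (q ^ 3) (q ^ 10) (q ^ 13) (q ^ 13) / QSeries.qPochInf q q) ∧
    (q ≠ 0 → HasSum
      (fun p : ℕ × ℕ => let n := p.1; let r := p.2
        q ^ ((n : ℤ) ^ 2 + 2 * (r : ℤ) ^ 2 + 2 * (n : ℤ) * (r : ℤ) - 1) *
          QSeries.qPoch q q (n + r) /
          (QSeries.qPoch q q (2 * n + 2 * r) * QSeries.qPoch q q r * QSeries.qPoch q q n) *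
          (q ^ r - 1 + q ^ (2 * r + 1) + q ^ (n + r + 1) - q ^ (n + 2 * r) + q ^ n
            + q ^ (2 * n + 1) - q ^ (2 * n + r) - q ^ (n + 2 * r + 1)
            - q ^ (2 * n + r + 1) + q ^ (2 * n + 2 * r)))
      (QSeries.qPochInf₃ (q ^ 4) (q ^ 9) (q ^ 13) (q ^ 13) / QSeries.qPochInf q q)) ∧
    HasSum
      (fun p : ℕ × ℕ => let n := p.1; let r := p.2
        q ^ (n ^ 2 + 2 * r ^ 2 + 2 * n * r) * QSeries.qPoch q q (n + r) *
          (q ^ n + q ^ r - q ^ (n + r)) /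
          (QSeries.qPoch q q (2 * n + 2 * r) * QSeries.qPoch q q r * QSeries.qPoch q q n))
      (QSeries.qPochInf₃ (q ^ 5) (q ^ 8) (q ^ 13) (q ^ 13) / QSeries.qPochInf q q) ∧
    HasSum
      (fun p : ℕ × ℕ => let n := p.1; let r := p.2
        q ^ (n ^ 2 + 2 * r ^ 2 + 2 * n * r) * QSeries.qPoch q q (n + r) /
          (QSeries.qPoch q q (2 * n + 2 * r) * QSeries.qPoch q q r * QSeries.qPoch q q n))
      (QSeries.qPochInf₃ (q ^ 6) (q ^ 7) (q ^ 13) (q ^ 13) / QSeries.qPochInf q q) := by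
  refine ⟨(QSeries.hasSum_oddTerm_one_twelve hq).congr_fun fun p => ?_,
    (QSeries.hasSum_oddTerm_two_eleven hq).congr_fun fun p => ?_,
    (QSeries.hasSum_oddTerm_three_ten hq).congr_fun fun p => ?_,
    fun hq0 => (QSeries.hasSum_evenTerm_four_nine hq hq0).congr_fun fun p => ?four_nine,
    (QSeries.hasSum_evenTerm_five_eight hq).congr_fun fun p => ?_,
    (QSeries.hasSum_evenTerm_six_seven hq).congr_fun fun p => ?_⟩
  case four_nine =>
    have hpow : q ^ ((p.1 : ℤ) ^ 2 + 2 * (p.2 : ℤ) ^ 2 + 2 * (p.1 : ℤ) * (p.2 : ℤ) - 1) =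
        q ^ (p.1 ^ 2 + 2 * p.2 ^ 2 + 2 * p.1 * p.2) * q⁻¹ := by
      rw [zpow_sub_one₀ hq0]
      norm_cast
    simp only [QSeries.evenTerm, hpow]
    ring
  all_goals
    simp only [QSeries.evenTerm, QSeries.oddTerm]
    ring
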